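/- Let $\mathcal S,\mathcal A$ be finite non-empty sets, $d\ge 0$ and $H\ge 1$ integers, and $\phi:\mathcal S\times\mathcal A\to\mathbb R^d$ a feature map with $\|\phi(s,a)\|\le 1$ (Euclidean norm) whose values span $\mathbb R^d$. Let $\nu$ be a measure on $\mathbb R$ with $\nu(\mathbb R\setminus[0,1])=0$. An episodic MDP $\mathcal M$ with horizon $H$ consists, for every $h\in[H]$ and $(s,a)$, of a probability distribution $p_{\mathcal M,h}(s,a,\cdot)$ on $\mathcal S$ (next state) and a probability distribution $q_{\mathcal M,h}(s,a,\cdot)$ on $\mathbb R$ (reward), with mean $r_{\mathcal M,h}(s,a)$. Let $\mathbb M$ be the set of linear ones, i.e. those such that $q_{\mathcal M,h}(s,a,\cdot)\ll\nu$ for all $h,s,a$, and such that for each $h$ there are $\mu_h:\mathcal S\to\mathbb R^d$ and $\theta_h\in\mathbb R^d$ with $p_{\mathcal M,h}(s,a,s')=\phi(s,a)^\top\mu_h(s')$, $r_{\mathcal M,h}(s,a)=\phi(s,a)^\top\theta_h$ for all $s,a,s'$, $\|\theta_h\|\le\sqrt d$ and $\big\|\sum_s|\mu_h(s)|\big\|\le\sqrt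 d$ (absolute values taken coordinatewise). Let $\mathcal C\subseteq\mathbb M$ be a model class: $\mathcal C=\mathbb M$, or any subset of it, such as the MDPs in $\mathbb M$ whose optimal policy is unique. A policy is a map $\pi:[H]\times\mathcal S\to\mathcal A$. Put $V^\pi_{\mathcal M}(s)=\mathbb E_{\mathcal M}\big[\sum_{k=1}^H r_{\mathcal M,k}(s_k,\pi_k(s_k))\mid s_1=s\big]$ and $V^\star_{\mathcal M}=\max_\pi V^\pi_{\mathcal M}$; let $\Pi^\star_\varepsilon(\mathcal M)$ be the set of policies $\pi$ with $V_{\mathcal M}^\pi(s)\ge V_{\mathcal M}^\star(s)-\varepsilon$ for all $s$. Write $\mathcal M\ll\mathcal M'$ if $p_{\mathcal M,h}(s,a,\cdot)\ll p_{\mathcal M',h}(s,a,\cdot)$ and $q_{\mathcal M,h}(s,a,\cdot)\ll q_{\mathcal M',h}(s,a,\cdot)$ for all $h,s,a$, and let $$\mathrm{KL}_{\mathcal M|\mathcal M'}(h,s,a)=\mathrm{KL}\big(q_{\mathcal M,h}(s,a,\cdot)\,\|\,q_{\mathcal M',h}(s,a,\cdot)\big)+\mathrm{KL}\big(p_{\mathcal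 M,h}(s,a,\cdot)\,\|\,p_{\mathcal M',h}(s,a,\cdot)\big),$$ $$\mathrm{Alt}_\varepsilon(\mathcal M)=\{\mathcal M'\in\mathcal C:\ \mathcal M\ll\mathcal M',\ \Pi^\star_\varepsilon(\mathcal M)\cap\Pi^\star_\varepsilon(\mathcal M')=\emptyset\}.$$ A learning algorithm proceeds in rounds. In each round and successively for $h=1,\dots,H$ it selects a pair $(s,a)$, as a measurable function of an internal random seed and of all results observed so far, and observes independently a reward drawn from $q_{\mathcal M,h}(s,a,\cdot)$ and a next state drawn from $p_{\mathcal M,h}(s,a,\cdot)$. The number $\tau\in\{0,1,\dots\}\cup\{\infty\}$ of rounds after which it stops is a stopping time for the filtration generated by the seed and the results of the completed rounds, and the policy $\hat\pi$ that it outputs is measurable with respect to the information at time $\tau$. It is $(\delta,\varepsilon)$-PAC if $\mathbb P_{\mathcal M}[\tau<\infty,\ \hat\pi\in\Pi^\star_\varepsilon(\mathcal M)]\ge1-\delta$ for every $\mathcal M\in\mathcal C$. **Proposition.** Let $\delta\in(0,1/2]$ and $\varepsilon>0$. For every $(\delta,\varepsilon)$-PAC algorithm and every $\mathcal M\in\mathcal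 C$, $$\mathbb E_{\mathcal M}[\tau]\ \ge\ T^\star(\mathcal M)\,\mathrm{kl}(\delta,1-\delta),\qquad T^\star(\mathcal M)^{-1}=\sup_{\omega\in(\Sigma_{\mathcal S\times\mathcal A})^H}\ \inf_{\mathcal M'\in\mathrm{Alt}_\varepsilon(\mathcal M)}\ \sum_{h,s,a}\omega_{h,s,a}\,\mathrm{KL}_{\mathcal M|\mathcal M'}(h,s,a),$$ where $\Sigma_{\mathcal S\times\mathcal A}$ is the set of probability vectors on $\mathcal S\times\mathcal A$ and $\mathrm{kl}(a,b)$ is the Kullback-Leibler divergence between Bernoulli distributions of means $a$ and $b$. All quantities are in $[0,\infty]$, with $\inf\emptyset=\infty$, $1/\infty=0$, $1/0=\infty$ and $0\cdot\infty=0$. -/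

import Mathlib

open MeasureTheory ProbabilityTheory InformationTheory
open scoped ENNReal

universe u v

noncomputable section

namespace LinearRL

/-- An episodic Markov decision process with finite horizon `H`: for each step `h`, the transition
probabilities `p_h(s, a, ·)` and the reward distributions `q_h(s, a, ·)`. -/
structure EpisodicMDP (S : Type u) (A : Type v) (H : ℕ) where
  /-- the law `p_h(s, a, ·)` of the next state -/
  trans : Fin H → S → A → PMF S
  /-- the law `q_h(s, a, ·)` of the collected reward -/
  reward : Fin H → S → A → ProbabilityMeasure ℝ

/-- A (deterministic) control policy maps, in each step, states to actions. -/
abbrev Policy (S : Type u) (A : Type v) (H : ℕ) : Type (max u v) := Fin H → S → A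

/-- The total mass vector `∑_s |μ(s)|` of a family of `d` signed measures on the finite set `S`
(coordinatewise absolute values). -/
def totalMass {S : Type u} [Fintype S] {d : ℕ} (μ : S → EuclideanSpace ℝ (Fin d)) :
    EuclideanSpace ℝ (Fin d) :=
  WithLp.toLp 2 fun i => ∑ s, |μ s i|

/-- The standing conditions on the feature map: norms at most one, and the features span `ℝ^d`. -/
def IsFeatureMap {S : Type u} {A : Type v} {d : ℕ} (φ : S → A → EuclideanSpace ℝ (Fin d)) : Prop :=
  (∀ s a, ‖φ s a‖ ≤ 1) ∧ Submodule.span ℝ (Set.range fun x : S × A => φ x.1 x.2) = ⊤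

/-- The law of a Bernoulli variable of mean `a ∈ [0, 1]`. -/
def bernoulliLaw (a : ℝ) : Measure Bool :=
  ENNReal.ofReal a • Measure.dirac true + ENNReal.ofReal (1 - a) • Measure.dirac false

/-- `kl(a, b)`: the Kullback-Leibler divergence between Bernoulli laws of means `a` and `b`. -/
def bernoulliKL (a b : ℝ) : ℝ≥0∞ := klDiv (bernoulliLaw a) (bernoulliLaw b)

namespace EpisodicMDP

variable {S : Type u} {A : Type v} {H : ℕ}

/-- The mean reward `r_h(s, a)`. -/
def meanReward (M : EpisodicMDP S A H) (h : Fin H) (s : S) (a : A) : ℝ :=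
  ∫ x, x ∂(M.reward h s a : Measure ℝ)

/-- The law of the state reached after `k` steps (`k < H`) when policy `π` is followed from state
`s` in the first step. (Beyond the horizon the state is frozen; these values are never used.) -/
def stateLaw (M : EpisodicMDP S A H) (π : Policy S A H) (s : S) : ℕ → PMF S
  | 0 => PMF.pure s
  | k + 1 => (stateLaw M π s k).bind fun x =>
      if hk : k < H then M.trans ⟨k, hk⟩ x (π ⟨k, hk⟩ x) else PMF.pure x

/-- The value function of `π` at the first step: the expected sum of the mean rewards over the `H`
steps, starting from `s`. -/
def value [Fintype S] (M : EpisodicMDP S A H) (π : Policy S A H) (s : S) : ℝ :=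
  ∑ k : Fin H, ∑ x : S, (M.stateLaw π s k x).toReal * M.meanReward k x (π k x)

/-- The optimal value function at the first step. -/
def optValue [Fintype S] (M : EpisodicMDP S A H) (s : S) : ℝ :=
  ⨆ π : Policy S A H, M.value π s

/-- The set of policies that are `ε`-optimal for `M` (from every state, at the first step). -/
def epsOptimal [Fintype S] (ε : ℝ) (M : EpisodicMDP S A H) : Set (Policy S A H) :=
  {π | ∀ s, M.optValue s - ε ≤ M.value π s}

/-- The episodic linear MDPs with feature map `φ` whose reward distributions are absolutely
continuous with respect to `ν`. -/
def linearMDPs [Fintype S] {d : ℕ} (φ : S → A → EuclideanSpace ℝ (Fin d)) (ν : Measure ℝ) :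
    Set (EpisodicMDP S A H) :=
  {M | (∀ h s a, (M.reward h s a : Measure ℝ) ≪ ν) ∧
    ∀ h : Fin H, ∃ (μ : S → EuclideanSpace ℝ (Fin d)) (θ : EuclideanSpace ℝ (Fin d)),
      (∀ s a s', (M.trans h s a s').toReal = inner ℝ (φ s a) (μ s')) ∧
      (∀ s a, M.meanReward h s a = inner ℝ (φ s a) θ) ∧
      ‖θ‖ ≤ Real.sqrt d ∧ ‖totalMass μ‖ ≤ Real.sqrt d}

variable [MeasurableSpace S]

/-- `M ≪ M'`. -/
def AbsCont (M M' : EpisodicMDP S A H) : Prop :=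
  ∀ h s a, (M.trans h s a).toMeasure ≪ (M'.trans h s a).toMeasure ∧
    (M.reward h s a : Measure ℝ) ≪ (M'.reward h s a : Measure ℝ)

/-- `KL_{M|M'}(h, s, a)`. -/
def kl (M M' : EpisodicMDP S A H) (h : Fin H) (s : S) (a : A) : ℝ≥0∞ :=
  klDiv (M.reward h s a : Measure ℝ) (M'.reward h s a : Measure ℝ) +
    klDiv (M.trans h s a).toMeasure (M'.trans h s a).toMeasure

/-- The alternative MDPs to `M` within the model class `𝓜`. -/
def alt [Fintype S] (𝓜 : Set (EpisodicMDP S A H)) (ε : ℝ) (M : EpisodicMDP S A H) :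
    Set (EpisodicMDP S A H) :=
  {M' | M' ∈ 𝓜 ∧ M.AbsCont M' ∧ epsOptimal ε M ∩ epsOptimal ε M' = ∅}

/-- The inverse characteristic time
`sup_{ω ∈ Σ^H} inf_{M' ∈ Alt(M)} ∑_{h, s, a} ω_{h, s, a} KL_{M|M'}(h, s, a)`,
with values in `[0, ∞]`. -/
def invCharTime [Fintype S] [Fintype A] (𝓜 : Set (EpisodicMDP S A H)) (ε : ℝ)
    (M : EpisodicMDP S A H) : ℝ≥0∞ :=
  ⨆ ω ∈ {ω : Fin H → S × A → ℝ | ∀ h, ω h ∈ stdSimplex ℝ (S × A)},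
    ⨅ M' ∈ alt 𝓜 ε M, ∑ h : Fin H, ∑ x : S × A, ENNReal.ofReal (ω h x) * M.kl M' h x.1 x.2

/-- The characteristic time `T⋆(M)`, with `1 / 0 = ∞` and `1 / ∞ = 0`. -/
def charTime [Fintype S] [Fintype A] (𝓜 : Set (EpisodicMDP S A H)) (ε : ℝ)
    (M : EpisodicMDP S A H) : ℝ≥0∞ :=
  (invCharTime 𝓜 ε M)⁻¹

/-- The kernel sending a (state, action) pair to the law `q_h(s, a, ·) ⊗ p_h(s, a, ·)` of the
observed reward and next state in step `h`. -/
def obsKernel [Countable S] [Countable A] [MeasurableSingletonClass S] [MeasurableSpace A]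
    [MeasurableSingletonClass A] (M : EpisodicMDP S A H) (h : Fin H) : Kernel (S × A) (ℝ × S) :=
  Kernel.ofFunOfCountable fun x =>
    (M.reward h x.1 x.2 : Measure ℝ).prod (M.trans h x.1 x.2).toMeasure

instance [Countable S] [Countable A] [MeasurableSingletonClass S] [MeasurableSpace A]
    [MeasurableSingletonClass A] (M : EpisodicMDP S A H) (h : Fin H) :
    IsMarkovKernel (M.obsKernel h) :=
  ⟨fun x => by
    change IsProbabilityMeasure
      ((M.reward h x.1 x.2 : Measure ℝ).prod (M.trans h x.1 x.2).toMeasure)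
    infer_instance⟩

end EpisodicMDP

/-- What is recorded along the interaction: in position `0` the internal random seed of the learner
(an element of `U`), in position `n + 1` the reward and next state returned by the `n`-th sample. -/
def Rec (U S : Type u) : ℕ → Type u
  | 0 => U
  | _ + 1 => ℝ × S

instance (U S : Type u) [MeasurableSpace U] [MeasurableSpace S] :
    ∀ n, MeasurableSpace (Rec U S n)
  | 0 => inferInstanceAs (MeasurableSpace U)
  | _ + 1 => inferInstanceAs (MeasurableSpace (ℝ × S))

/-- The information available after `n` samples. -/
abbrev History (U S : Type u) (n : ℕ) : Type u := (i : Finset.Iic n) → Rec U S i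

/-- The filtration indexed by rounds. A round consists of one sample in each of the `H` steps, so
that after `t` rounds the learner knows its seed and the results of the first `t * H` samples. -/
def roundFiltration (U S : Type u) [MeasurableSpace U] [MeasurableSpace S] (H : ℕ) :
    Filtration ℕ (inferInstance : MeasurableSpace ((n : ℕ) → Rec U S n)) where
  seq t := Filtration.piLE (X := Rec U S) (t * H)
  mono' _ _ hst := (Filtration.piLE (X := Rec U S)).mono (Nat.mul_le_mul_right H hst)
  le' t := (Filtration.piLE (X := Rec U S)).le (t * H)

/-- A learning algorithm with internal random seed in `U`. The samples are numbered by
`n = t * H + h`: sample `n` is taken in step `h = n % H` of round `t = n / H`. -/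
structure LearningAlgorithm (U S : Type u) (A : Type v) [MeasurableSpace U] [MeasurableSpace S]
    [MeasurableSpace A] (H : ℕ) where
  /-- the law of the seed -/
  seedLaw : ProbabilityMeasure U
  /-- the sampling rule: the pair selected for sample `n`, given the seed and the results of all
  the previous samples -/
  select : (n : ℕ) → History U S n → S × A
  measurable_select : ∀ n, Measurable (select n)
  /-- the number of rounds after which the algorithm stops (possibly `∞`) -/
  τ : ((n : ℕ) → Rec U S n) → ℕ∞
  isStoppingTime : IsStoppingTime (roundFiltration U S H) τ
  /-- the decision rule: the policy that is output, based on the information at time `τ` -/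
  output : ((n : ℕ) → Rec U S n) → Policy S A H
  measurable_output : ∀ π, MeasurableSet[isStoppingTime.measurableSpace] {x | output x = π}

namespace LearningAlgorithm

variable {U S : Type u} {A : Type v} {H : ℕ} [MeasurableSpace U]
  [Fintype S] [MeasurableSpace S] [MeasurableSingletonClass S]
  [Fintype A] [MeasurableSpace A] [MeasurableSingletonClass A] [NeZero H]

/-- The conditional law of the result of sample `n` given the history, when the algorithm interacts
with `M`. -/
def stepKernel (alg : LearningAlgorithm U S A H) (M : EpisodicMDP S A H) (n : ℕ) :
    Kernel (History U S n) (Rec U S (n + 1)) :=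
  (M.obsKernel (Fin.ofNat H n)).comap (alg.select n) (alg.measurable_select n)

instance (alg : LearningAlgorithm U S A H) (M : EpisodicMDP S A H) (n : ℕ) :
    IsMarkovKernel (alg.stepKernel M n) :=
  inferInstanceAs (IsMarkovKernel
    ((M.obsKernel (Fin.ofNat H n)).comap (alg.select n) (alg.measurable_select n)))

/-- The law of the initial record, that is, of the seed. -/
def initialLaw (alg : LearningAlgorithm U S A H) : Measure (Rec U S 0) :=
  (alg.seedLaw : Measure U)

instance (alg : LearningAlgorithm U S A H) : IsProbabilityMeasure alg.initialLaw :=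
  inferInstanceAs (IsProbabilityMeasure (alg.seedLaw : Measure U))

/-- The law `ℙ_M` of the whole interaction of the algorithm with `M`. -/
def law (alg : LearningAlgorithm U S A H) (M : EpisodicMDP S A H) :
    Measure ((n : ℕ) → Rec U S n) :=
  Kernel.trajMeasure (X := Rec U S) alg.initialLaw (alg.stepKernel M)

instance (alg : LearningAlgorithm U S A H) (M : EpisodicMDP S A H) :
    IsProbabilityMeasure (alg.law M) := by
  unfold law
  infer_instance

/-- The algorithm is `(δ, ε)`-PAC on the model class `𝓜`: for every `M` in the class it stops and
outputs an `ε`-optimal policy with probability at least `1 - δ`. -/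
def IsPAC (alg : LearningAlgorithm U S A H) (𝓜 : Set (EpisodicMDP S A H)) (δ ε : ℝ) : Prop :=
  ∀ M ∈ 𝓜,
    ENNReal.ofReal (1 - δ) ≤ alg.law M {x | alg.τ x ≠ ⊤ ∧ alg.output x ∈ M.epsOptimal ε}

/-- The expected sample complexity `𝔼_M[τ]`. -/
def expectedSamples (alg : LearningAlgorithm U S A H) (M : EpisodicMDP S A H) : ℝ≥0∞ :=
  ∫⁻ x, (alg.τ x : ℝ≥0∞) ∂(alg.law M)

end LearningAlgorithm

end LinearRL

end

/-! Fix `M'` in the alternative set. An `ε`-optimal policy for `M` is output with probability at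
least `1 - δ` under `M`, and at most `δ` under `M'` since the two optimal sets are disjoint. Telling
the models apart costs information: with `N h x` the expected number of rounds before stopping in
which `x` is selected in step `h`, `kl(δ, 1 - δ) ≤ ∑ N h x * KL(h, x)`
(`bernoulliKL_le_sum_expectedVisits_mul_kl`). Each round takes one sample per step, so `∑ x, N h x =
𝔼[τ]` for every `h`, and `N / 𝔼[τ]` is an admissible allocation `ω`, the same for all `M'`. Infimum
over `M'` and supremum over `ω` finish the proof.

The random, possibly infinite `τ` is handled by a hybrid law (`exists_stopped_law`): follow `M'`
until stopping and `M` afterwards. It agrees with `M'` on what is output at a finite time. Since it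
does not differ from `M` after stopping, the chain rule bounds its divergence on every finite
horizon by the same sum. A Donsker-Varadhan bound on finite-time events, followed by a limit, gives
the inequality. -/

noncomputable section

/-! ### Kullback-Leibler divergence: conditional form, products, Donsker-Varadhan bound -/

namespace InformationTheory

variable {α β : Type*} {mα : MeasurableSpace α} {mβ : MeasurableSpace β}

/-- The conditional Kullback-Leibler divergence as an integral. -/
lemma klDiv_compProd_right_eq_lintegral [MeasurableSpace.CountableOrCountablyGenerated α β]
    (μ : Measure α) [IsFiniteMeasure μ] (κ η : Kernel α β) [IsFiniteKernel κ] [IsFiniteKernel η]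
    (h : ∀ a, κ a ≪ η a) :
    klDiv (μ ⊗ₘ κ) (μ ⊗ₘ η) = ∫⁻ a, klDiv (κ a) (η a) ∂μ := by
  have hκ : κ = η.withDensity (Kernel.rnDeriv κ η) := by
    ext1 a
    exact (Kernel.withDensity_rnDeriv_eq (h a)).symm
  have hac : μ ⊗ₘ κ ≪ μ ⊗ₘ η :=
    Measure.AbsolutelyContinuous.compProd_right (Filter.Eventually.of_forall h)
  have hmeas : Measurable (fun p : α × β => Kernel.rnDeriv κ η p.1 p.2) :=
    Kernel.measurable_rnDeriv κ η
  -- The joint density is the fibrewise one. As `klFun` has values in `[0, ∞]` here, Tonelli then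
  -- applies with no integrability condition.
  have hrn : (μ ⊗ₘ κ).rnDeriv (μ ⊗ₘ η) =ᵐ[μ ⊗ₘ η] fun p => Kernel.rnDeriv κ η p.1 p.2 := by
    have : μ ⊗ₘ κ = (μ ⊗ₘ η).withDensity fun p => Kernel.rnDeriv κ η p.1 p.2 := by
      have : IsSFiniteKernel (η.withDensity (Kernel.rnDeriv κ η)) := hκ ▸ inferInstance
      conv_lhs => rw [hκ]
      exact Measure.compProd_withDensity (Kernel.measurable_rnDeriv κ η)
    rw [this]
    exact Measure.rnDeriv_withDensity _ hmeas
  rw [klDiv_eq_lintegral_klFun_of_ac hac,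
    lintegral_congr_ae (hrn.mono fun p hp => by rw [hp]),
    Measure.lintegral_compProd (by fun_prop)]
  refine lintegral_congr fun a => ?_
  rw [klDiv_eq_lintegral_klFun_of_ac (h a)]
  exact lintegral_congr_ae
    ((Kernel.rnDeriv_eq_rnDeriv_measure (κ := κ)).mono fun b hb => by simp only [hb])

/-- A product is a composition-product with a constant kernel, so the chain rule applies and its
conditional term is constant. -/
lemma klDiv_prod_eq_add (μ μ' : Measure α) (ν ν' : Measure β)
    [MeasurableSpace.CountableOrCountablyGenerated α β]
    [IsProbabilityMeasure μ] [IsProbabilityMeasure μ']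
    [IsProbabilityMeasure ν] [IsProbabilityMeasure ν'] (h : ν ≪ ν') :
    klDiv (μ.prod ν) (μ'.prod ν') = klDiv μ μ' + klDiv ν ν' := by
  rw [← Measure.compProd_const, ← Measure.compProd_const, klDiv_compProd_eq_add,
    klDiv_compProd_right_eq_lintegral _ _ _ fun a => by simpa using h]
  simp

/-- The Donsker-Varadhan lower bound for a multiple of an indicator function. -/
lemma mul_measureReal_sub_log_le_toReal_klDiv (μ ν : Measure α) [IsProbabilityMeasure μ]
    [IsProbabilityMeasure ν] (h : klDiv μ ν ≠ ∞) {s : Set α} (hs : MeasurableSet s) (c : ℝ) :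
    c * μ.real s - Real.log (1 - ν.real s + ν.real s * Real.exp c) ≤ (klDiv μ ν).toReal := by
  obtain ⟨hac, hint⟩ := klDiv_ne_top_iff.1 h
  set f : α → ℝ := s.indicator fun _ => c with hf
  have hfm : Measurable f := measurable_const.indicator hs
  have hfi (ρ : Measure α) [IsProbabilityMeasure ρ] : Integrable f ρ :=
    (integrable_const c).indicator hs
  have hexp : (fun x => Real.exp (f x)) =
      fun x => 1 + s.indicator (fun _ => Real.exp c - 1) x := by
    ext x
    by_cases hx : x ∈ s <;> simp [hf, hx]
  have hei : Integrable (fun x => Real.exp (f x)) ν := by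
    rw [hexp]
    exact (integrable_const 1).add ((integrable_const _).indicator hs)
  have hev : ∫ x, Real.exp (f x) ∂ν = 1 - ν.real s + ν.real s * Real.exp c := by
    rw [hexp, integral_add (integrable_const 1) ((integrable_const _).indicator hs),
      integral_indicator_const _ hs]
    simp
    ring
  have hfv : ∫ x, f x ∂μ = c * μ.real s := by
    rw [hf, integral_indicator_const _ hs, smul_eq_mul, mul_comm]
  have : IsProbabilityMeasure (ν.tilted f) := isProbabilityMeasure_tilted hei
  have hac' : μ ≪ ν.tilted f := hac.trans (absolutelyContinuous_tilted hei)
  -- The divergence of `μ` from `ν` tilted by `f` is nonnegative; expanding its log-likelihood ratio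
  -- gives the bound.
  have key := integral_llr_add_sub_measure_univ_nonneg hac'
    (integrable_llr_tilted_right hac (hfi μ) hint hei)
  rw [integral_llr_tilted_right hac (hfi μ) hei hint, hfv, hev] at key
  rw [toReal_klDiv hac hint]
  simp only [probReal_univ] at key ⊢
  linarith

end InformationTheory

/-! ### Laws of trajectories: chain rule and locality -/

section Trajectory

open Preorder Finset

variable {X : ℕ → Type*}

/-- Lets a finite history be completed to a full trajectory, on which `τ` can be evaluated. -/
lemma surjective_frestrictLe [∀ n, Nonempty (X n)] (n : ℕ) :
    Function.Surjective (frestrictLe (π := X) n) := fun y =>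
  ⟨fun i => if hi : i ≤ n then y ⟨i, mem_Iic.2 hi⟩ else Classical.arbitrary (X i), by
    ext ⟨i, hi⟩
    simp [mem_Iic.1 hi]⟩

variable [∀ n, MeasurableSpace (X n)]

/-- Extend a trajectory up to time `n` by its value at time `n + 1`. -/
def snocTraj (n : ℕ) (p : ((i : Iic n) → X i) × X (n + 1)) : (i : Iic (n + 1)) → X i :=
  IicProdIoc n (n + 1) (p.1, MeasurableEquiv.piSingleton n p.2)

lemma measurable_snocTraj (n : ℕ) : Measurable (snocTraj (X := X) n) := by
  unfold snocTraj
  exact measurable_IicProdIoc.comp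
    (measurable_fst.prodMk ((MeasurableEquiv.piSingleton n).measurable.comp measurable_snd))

lemma snocTraj_frestrictLe (n : ℕ) (x : (n : ℕ) → X n) :
    snocTraj n (frestrictLe n x, x (n + 1)) = frestrictLe (n + 1) x := by
  ext ⟨i, hi⟩
  rw [mem_Iic] at hi
  rcases hi.lt_or_eq with h | rfl
  · simp [snocTraj, IicProdIoc, Nat.lt_succ_iff.1 h]
  · simp [snocTraj, IicProdIoc, MeasurableEquiv.piSingleton]

lemma frestrictLe₂_snocTraj {m n : ℕ} (hmn : m ≤ n) (p : ((i : Iic n) → X i) × X (n + 1)) :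
    frestrictLe₂ (hmn.trans n.le_succ) (snocTraj n p) = frestrictLe₂ (π := X) hmn p.1 := by
  ext ⟨i, hi⟩
  rw [mem_Iic] at hi
  simp [snocTraj, IicProdIoc, hi.trans hmn]

variable (μ₀ : Measure (X 0)) (κ η : (n : ℕ) → Kernel ((i : Iic n) → X i) (X (n + 1)))
  [∀ n, IsMarkovKernel (κ n)] [∀ n, IsMarkovKernel (η n)]

lemma map_frestrictLe_zero_trajMeasure :
    (Kernel.trajMeasure μ₀ κ).map (frestrictLe 0) =
      μ₀.map (MeasurableEquiv.piUnique fun i : Iic 0 => X i).symm := by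
  rw [Kernel.trajMeasure, Measure.map_comp _ _ (by fun_prop), Kernel.traj_map_frestrictLe,
    Kernel.partialTraj_self, Measure.id_comp]
  rfl

variable [IsProbabilityMeasure μ₀]

lemma map_frestrictLe_succ_trajMeasure (n : ℕ) :
    (Kernel.trajMeasure μ₀ κ).map (frestrictLe (n + 1)) =
      ((Kernel.trajMeasure μ₀ κ).map (frestrictLe n) ⊗ₘ κ n).map (snocTraj n) := by
  rw [Kernel.map_frestrictLe_trajMeasure_compProd_eq_map_trajMeasure,
    Measure.map_map (measurable_snocTraj n) (by fun_prop)]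
  congr 1
  ext1 x
  exact (snocTraj_frestrictLe n x).symm

/-- The chain rule for the Kullback-Leibler divergence between the laws of two trajectories. -/
lemma klDiv_map_frestrictLe_trajMeasure_le
    [∀ n, MeasurableSpace.CountableOrCountablyGenerated ((i : Iic n) → X i) (X (n + 1))]
    (h : ∀ n y, κ n y ≪ η n y) (n : ℕ) :
    klDiv ((Kernel.trajMeasure μ₀ κ).map (frestrictLe n))
        ((Kernel.trajMeasure μ₀ η).map (frestrictLe n)) ≤
      ∑ i ∈ range n,
        ∫⁻ x, klDiv (κ i (frestrictLe i x)) (η i (frestrictLe i x)) ∂Kernel.trajMeasure μ₀ κ := by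
  have hprob (ξ : (n : ℕ) → Kernel ((i : Iic n) → X i) (X (n + 1))) [∀ n, IsMarkovKernel (ξ n)]
      (n : ℕ) : IsProbabilityMeasure ((Kernel.trajMeasure μ₀ ξ).map (frestrictLe n)) :=
    Measure.isProbabilityMeasure_map (by fun_prop)
  induction n with
  | zero =>
    have := hprob κ 0
    rw [(map_frestrictLe_zero_trajMeasure μ₀ η).trans (map_frestrictLe_zero_trajMeasure μ₀ κ).symm,
      klDiv_self]
    exact zero_le
  | succ n ih =>
    have := hprob κ n
    have := hprob η n
    rw [map_frestrictLe_succ_trajMeasure, map_frestrictLe_succ_trajMeasure, sum_range_succ]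
    refine (klDiv_map_le _ _ (measurable_snocTraj n)).trans ?_
    rw [klDiv_compProd_eq_add, klDiv_compProd_right_eq_lintegral _ _ _ (h n)]
    exact add_le_add ih (lintegral_map_le _ (frestrictLe n))

/-- Two trajectories driven by kernels that coincide on the sets `D m` have the same law on the
events up to time `n` that force the trajectory to lie in `D m` for all `m < n`. -/
lemma map_frestrictLe_trajMeasure_apply_eq {D : (n : ℕ) → Set ((i : Iic n) → X i)}
    (hD : ∀ n, MeasurableSet (D n)) (h : ∀ n, ∀ y ∈ D n, κ n y = η n y) (n : ℕ)
    {B : Set ((i : Iic n) → X i)} (hB : MeasurableSet B)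
    (hBD : ∀ y ∈ B, ∀ m (hm : m < n), frestrictLe₂ hm.le y ∈ D m) :
    (Kernel.trajMeasure μ₀ κ).map (frestrictLe n) B =
      (Kernel.trajMeasure μ₀ η).map (frestrictLe n) B := by
  induction n with
  | zero => rw [map_frestrictLe_zero_trajMeasure, map_frestrictLe_zero_trajMeasure]
  | succ n ih =>
    -- `G` collects the histories all of whose prefixes lie in the sets `D m`. The induction
    -- hypothesis covers every measurable subset of `G`, and no history outside `G` has a
    -- continuation in `B`.
    set G : Set ((i : Iic n) → X i) := ⋂ m : Iic n, frestrictLe₂ (mem_Iic.1 m.2) ⁻¹' D m with hG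
    have hGm : MeasurableSet G := .iInter fun m => (measurable_frestrictLe₂ _) (hD m)
    have hGD : ∀ y ∈ G, y ∈ D n := fun y hy => Set.mem_iInter.1 hy ⟨n, mem_Iic.2 le_rfl⟩
    have hrestr : ((Kernel.trajMeasure μ₀ κ).map (frestrictLe n)).restrict G =
        ((Kernel.trajMeasure μ₀ η).map (frestrictLe n)).restrict G := by
      ext s hs
      rw [Measure.restrict_apply hs, Measure.restrict_apply hs]
      refine ih (hs.inter hGm) fun y hy m hm => ?_
      exact Set.mem_iInter.1 hy.2 ⟨m, mem_Iic.2 hm.le⟩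
    have hslice : ∀ y ∉ G, Prod.mk y ⁻¹' (snocTraj n ⁻¹' B) = ∅ := by
      intro y hy
      refine Set.eq_empty_of_forall_notMem fun z hz => hy (Set.mem_iInter.2 fun m => ?_)
      have := hBD _ hz m (Nat.lt_succ_of_le (mem_Iic.1 m.2))
      rwa [frestrictLe₂_snocTraj (mem_Iic.1 m.2)] at this
    have key (ξ : (n : ℕ) → Kernel ((i : Iic n) → X i) (X (n + 1))) [∀ n, IsMarkovKernel (ξ n)] :
        (Kernel.trajMeasure μ₀ ξ).map (frestrictLe (n + 1)) B =
          ∫⁻ y in G, ξ n y (Prod.mk y ⁻¹' (snocTraj n ⁻¹' B))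
            ∂(Kernel.trajMeasure μ₀ ξ).map (frestrictLe n) := by
      have : IsProbabilityMeasure ((Kernel.trajMeasure μ₀ ξ).map (frestrictLe n)) :=
        Measure.isProbabilityMeasure_map (by fun_prop)
      rw [map_frestrictLe_succ_trajMeasure, Measure.map_apply (measurable_snocTraj n) hB,
        Measure.compProd_apply (measurable_snocTraj n hB)]
      refine (setLIntegral_eq_of_support_subset fun y hy => ?_).symm
      by_contra hyG
      exact hy (by simp [hslice y hyG])
    rw [key κ, key η, hrestr]
    exact setLIntegral_congr_fun hGm fun y hy => by rw [h n y (hGD y hy)]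

end Trajectory

/-! ### Bernoulli divergence -/

namespace LinearRL

lemma lintegral_bernoulliLaw (a : ℝ) (f : Bool → ℝ≥0∞) :
    ∫⁻ b, f b ∂bernoulliLaw a =
      ENNReal.ofReal a * f true + ENNReal.ofReal (1 - a) * f false := by
  simp [bernoulliLaw]

lemma isProbabilityMeasure_bernoulliLaw {a : ℝ} (h0 : 0 ≤ a) (h1 : a ≤ 1) :
    IsProbabilityMeasure (bernoulliLaw a) :=
  ⟨by simp [bernoulliLaw, ← ENNReal.ofReal_add h0 (sub_nonneg.2 h1)]⟩

lemma integral_bernoulliLaw {a : ℝ} (h0 : 0 ≤ a) (h1 : a ≤ 1) (f : Bool → ℝ) :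
    ∫ b, f b ∂bernoulliLaw a = a * f true + (1 - a) * f false := by
  have := Measure.smul_finite (Measure.dirac true) (ENNReal.ofReal_ne_top (r := a))
  have := Measure.smul_finite (Measure.dirac false) (ENNReal.ofReal_ne_top (r := 1 - a))
  rw [bernoulliLaw, integral_add_measure .of_finite .of_finite, integral_smul_measure,
    integral_smul_measure, integral_dirac, integral_dirac, ENNReal.toReal_ofReal h0,
    ENNReal.toReal_ofReal (sub_nonneg.2 h1), smul_eq_mul, smul_eq_mul]

/-- The divergence `kl(δ, 1 - δ)` in closed form. -/
lemma bernoulliKL_self_compl {δ : ℝ} (h0 : 0 < δ) (h1 : δ < 1) :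
    bernoulliKL δ (1 - δ) = ENNReal.ofReal ((1 - 2 * δ) * Real.log ((1 - δ) / δ)) := by
  have h2 : 0 < 1 - δ := sub_pos.2 h1
  have := isProbabilityMeasure_bernoulliLaw h0.le h1.le
  have := isProbabilityMeasure_bernoulliLaw h2.le (sub_le_self 1 h0.le)
  set g : Bool → ℝ≥0∞ :=
    fun b => bif b then ENNReal.ofReal (δ / (1 - δ)) else ENNReal.ofReal ((1 - δ) / δ) with hg
  have hwd : bernoulliLaw δ = (bernoulliLaw (1 - δ)).withDensity g := by
    ext s hs
    rw [withDensity_apply _ hs, ← lintegral_indicator hs, ← lintegral_indicator_one hs,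
      lintegral_bernoulliLaw, lintegral_bernoulliLaw]
    have e1 : ENNReal.ofReal (1 - δ) * ENNReal.ofReal (δ / (1 - δ)) = ENNReal.ofReal δ := by
      rw [← ENNReal.ofReal_mul h2.le, mul_div_cancel₀ _ h2.ne']
    have e2 : ENNReal.ofReal δ * ENNReal.ofReal ((1 - δ) / δ) = ENNReal.ofReal (1 - δ) := by
      rw [← ENNReal.ofReal_mul h0.le, mul_div_cancel₀ _ h0.ne']
    by_cases ht : true ∈ s <;> by_cases hf : false ∈ s <;> simp [ht, hf, hg, e1, e2]
  have hac : bernoulliLaw δ ≪ bernoulliLaw (1 - δ) := by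
    rw [hwd]
    exact withDensity_absolutelyContinuous _ _
  have hrn : llr (bernoulliLaw δ) (bernoulliLaw (1 - δ)) =ᵐ[bernoulliLaw δ]
      fun b => Real.log (g b).toReal := by
    have := hac.ae_eq (Measure.rnDeriv_withDensity (bernoulliLaw (1 - δ)) (.of_discrete (f := g)))
    rw [← hwd] at this
    exact this.mono fun b hb => by simp only [llr, hb]
  rw [bernoulliKL, klDiv_of_ac_of_integrable hac .of_finite, integral_congr_ae hrn,
    integral_bernoulliLaw h0.le h1.le]
  congr 1
  have e3 : δ / (1 - δ) = ((1 - δ) / δ)⁻¹ := (inv_div _ _).symm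
  simp only [hg, cond_true, cond_false, ENNReal.toReal_ofReal (div_pos h0 h2).le,
    ENNReal.toReal_ofReal (div_pos h2 h0).le, probReal_univ]
  rw [e3, Real.log_inv]
  ring

end LinearRL

/-! ### Visit counts, the stopped law and the change of measure -/

namespace LinearRL

open Preorder

lemma EpisodicMDP.klDiv_obsKernel {S : Type u} {A : Type v} {H : ℕ} [Finite S] [Finite A]
    [MeasurableSpace S] [MeasurableSingletonClass S] [MeasurableSpace A]
    [MeasurableSingletonClass A] {M M' : EpisodicMDP S A H} (h : M.AbsCont M') (k : Fin H)
    (x : S × A) : klDiv (M.obsKernel k x) (M'.obsKernel k x) = M.kl M' k x.1 x.2 :=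
  klDiv_prod_eq_add _ _ _ _ (h k x.1 x.2).1

lemma EpisodicMDP.AbsCont.obsKernel {S : Type u} {A : Type v} {H : ℕ} [Finite S] [Finite A]
    [MeasurableSpace S] [MeasurableSingletonClass S] [MeasurableSpace A]
    [MeasurableSingletonClass A] {M M' : EpisodicMDP S A H} (h : M.AbsCont M') (k : Fin H)
    (x : S × A) : M.obsKernel k x ≪ M'.obsKernel k x :=
  (h k x.1 x.2).2.prod (h k x.1 x.2).1

namespace LearningAlgorithm

variable {U S : Type u} {A : Type v} {H : ℕ} [MeasurableSpace U] [MeasurableSpace S]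
  [MeasurableSpace A]

/-- Events known after `t` rounds are events about the first `t * H` samples. -/
lemma exists_preimage_of_roundFiltration {t n : ℕ} (htn : t * H ≤ n)
    {E : Set ((n : ℕ) → Rec U S n)} (hE : MeasurableSet[roundFiltration U S H t] E) :
    ∃ B : Set (History U S n), MeasurableSet B ∧ frestrictLe n ⁻¹' B = E := by
  have h : MeasurableSet[Filtration.piLE (X := Rec U S) n] E :=
    (Filtration.piLE (X := Rec U S)).mono htn E hE
  rw [Filtration.piLE_eq_comap_frestrictLe] at h
  exact h

/-- On `{τ = t}` the information at time `τ` is that of round `t`; there are only finitely many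
policies. -/
lemma measurableSet_stop_output_mem (alg : LearningAlgorithm U S A H) [Finite S] [Finite A]
    (P : Set (Policy S A H)) (t : ℕ) :
    MeasurableSet[roundFiltration U S H t] {x | alg.τ x = t ∧ alg.output x ∈ P} := by
  have h : MeasurableSet[alg.isStoppingTime.measurableSpace] {x | alg.output x ∈ P} := by
    have : {x | alg.output x ∈ P} = ⋃ π ∈ P, {x | alg.output x = π} := by
      ext x
      simp
    rw [this]
    exact MeasurableSet.biUnion P.to_countable fun π _ => alg.measurable_output π
  have h2 := h.inter (alg.isStoppingTime.measurableSet_eq_of_countable' t)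
  rw [alg.isStoppingTime.measurableSet_inter_eq_iff] at h2
  convert h2 using 1
  ext x
  exact and_comm

lemma measurableSet_lt_tau (alg : LearningAlgorithm U S A H) (t : ℕ) :
    MeasurableSet {ω | (t : ℕ∞) < alg.τ ω} :=
  (roundFiltration U S H).le t _ (alg.isStoppingTime.measurableSet_gt t)

lemma measurableSet_visit [MeasurableSingletonClass S]
    [MeasurableSingletonClass A]
    (alg : LearningAlgorithm U S A H) (t n : ℕ) (x : S × A) :
    MeasurableSet {ω | (t : ℕ∞) < alg.τ ω ∧ alg.select n (frestrictLe n ω) = x} :=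
  (alg.measurableSet_lt_tau t).inter
    (((alg.measurable_select n).comp (measurable_frestrictLe n)) (measurableSet_singleton x))

variable [Fintype S] [MeasurableSingletonClass S] [Fintype A] [MeasurableSingletonClass A]
  [NeZero H]

/-- The expected number of rounds in which the pair `x` is selected in step `h`. -/
def expectedVisits (alg : LearningAlgorithm U S A H) (M : EpisodicMDP S A H) (h : Fin H)
    (x : S × A) : ℝ≥0∞ :=
  ∑' t : ℕ, alg.law M
    {ω | (t : ℕ∞) < alg.τ ω ∧ alg.select (t * H + h) (frestrictLe (t * H + h) ω) = x}

/-- Exactly one pair is selected in step `h` of each round, and `τ` is the sum over `t` of the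
indicators of `t < τ`. -/
lemma sum_expectedVisits (alg : LearningAlgorithm U S A H) (M : EpisodicMDP S A H) (h : Fin H) :
    ∑ x, alg.expectedVisits M h x = alg.expectedSamples M := by
  have h1 (m : ℕ∞) : (m : ℝ≥0∞) = ∑' t : ℕ, if (t : ℕ∞) < m then 1 else 0 := by
    induction m using ENat.recTopCoe with
    | top => simp
    | coe m =>
      rw [tsum_eq_sum (s := Finset.range m) fun t ht => by simpa using ht]
      rw [Finset.sum_congr rfl fun t ht => if_pos (by simpa using ht)]
      simp
  have h2 (t : ℕ) : ∑ x, alg.law M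
      {ω | (t : ℕ∞) < alg.τ ω ∧ alg.select (t * H + h) (frestrictLe (t * H + h) ω) = x} =
        alg.law M {ω | (t : ℕ∞) < alg.τ ω} := by
    rw [← measure_biUnion_finset _ fun x _ => alg.measurableSet_visit t _ x]
    · congr 1
      ext ω
      simp
    · intro x _ y _ hxy
      exact Set.disjoint_left.2 fun ω hx hy => hxy (hx.2.symm.trans hy.2)
  have h3 : ∫⁻ ω, (alg.τ ω : ℝ≥0∞) ∂alg.law M = ∑' t : ℕ, alg.law M {ω | (t : ℕ∞) < alg.τ ω} := by
    simp_rw [h1]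
    rw [lintegral_tsum fun t => (Measurable.ite (alg.measurableSet_lt_tau t) measurable_const
      measurable_const).aemeasurable]
    refine tsum_congr fun t => ?_
    rw [← lintegral_indicator_one (alg.measurableSet_lt_tau t)]
    exact lintegral_congr fun ω => by simp [Set.indicator_apply]
  rw [expectedSamples, h3, ← tsum_congr h2, Summable.tsum_finsetSum fun _ _ => ENNReal.summable]
  rfl

/-- Reindexing by `n = t * H + h` turns the sample-by-sample chain rule into visit counts. -/
lemma tsum_select_mul_kl (alg : LearningAlgorithm U S A H) (M M' : EpisodicMDP S A H) :
    ∑' n : ℕ, ∑ x, alg.law M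
        {ω | ((n / H : ℕ) : ℕ∞) < alg.τ ω ∧ alg.select n (frestrictLe n ω) = x} *
          M.kl M' (Fin.ofNat H n) x.1 x.2 =
      ∑ h, ∑ x, alg.expectedVisits M h x * M.kl M' h x.1 x.2 := by
  set F : ℕ → ℕ → Fin H → ℝ≥0∞ := fun n t h => ∑ x, alg.law M
    {ω | (t : ℕ∞) < alg.τ ω ∧ alg.select n (frestrictLe n ω) = x} * M.kl M' h x.1 x.2 with hF
  calc ∑' n : ℕ, F n (n / H) (Fin.ofNat H n)
      = ∑' p : ℕ × Fin H, F (p.1 * H + p.2) p.1 p.2 := by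
        rw [← (Nat.divModEquiv H).tsum_eq fun p : ℕ × Fin H => F (p.1 * H + p.2) p.1 p.2]
        refine tsum_congr fun n => ?_
        have := (Nat.divModEquiv H).symm_apply_apply n
        change _ = F ((Nat.divModEquiv H).symm (Nat.divModEquiv H n)) _ _
        rw [this]
        rfl
    _ = ∑ h : Fin H, ∑' t : ℕ, F (t * H + h) t h := by
        rw [ENNReal.tsum_prod (f := fun t (h : Fin H) => F (t * H + h) t h), ENNReal.tsum_comm,
          tsum_fintype]
    _ = _ := by
        refine Finset.sum_congr rfl fun h _ => ?_
        rw [hF, Summable.tsum_finsetSum fun _ _ => ENNReal.summable]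
        exact Finset.sum_congr rfl fun x _ => ENNReal.tsum_mul_right

/-- The seed space is arbitrary, but `ℝ × S` is countably generated, which suffices for jointly
measurable kernel densities. -/
instance (n : ℕ) :
    MeasurableSpace.CountableOrCountablyGenerated (History U S n) (Rec U S (n + 1)) :=
  inferInstanceAs (MeasurableSpace.CountableOrCountablyGenerated (History U S n) (ℝ × S))

lemma klDiv_stepKernel (alg : LearningAlgorithm U S A H) {M M' : EpisodicMDP S A H}
    (h : M.AbsCont M') (n : ℕ) (y : History U S n) :
    klDiv (alg.stepKernel M n y) (alg.stepKernel M' n y) =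
      M.kl M' (Fin.ofNat H n) (alg.select n y).1 (alg.select n y).2 :=
  EpisodicMDP.klDiv_obsKernel h _ _

lemma stepKernel_absolutelyContinuous (alg : LearningAlgorithm U S A H) {M M' : EpisodicMDP S A H}
    (h : M.AbsCont M') (n : ℕ) (y : History U S n) :
    alg.stepKernel M n y ≪ alg.stepKernel M' n y :=
  h.obsKernel _ _

/-- The law of the interaction with `M'` up to the stopping time and with `M` afterwards: it gives
the same probability as `alg.law M'` to what the algorithm outputs, and its divergence from
`alg.law M` is controlled by the expected numbers of visits before stopping. -/
lemma exists_stopped_law [Nonempty S] (alg : LearningAlgorithm U S A H) {M M' : EpisodicMDP S A H}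
    (h : M.AbsCont M') :
    ∃ Q : Measure ((n : ℕ) → Rec U S n), IsProbabilityMeasure Q ∧
      (∀ (P : Set (Policy S A H)) (t : ℕ),
        Q {x | alg.τ x = t ∧ alg.output x ∈ P} =
          alg.law M' {x | alg.τ x = t ∧ alg.output x ∈ P}) ∧
      ∀ n, klDiv ((alg.law M).map (frestrictLe n)) (Q.map (frestrictLe n)) ≤
        ∑ k, ∑ x, alg.expectedVisits M k x * M.kl M' k x.1 x.2 := by
  classical
  have hU : Nonempty U := nonempty_of_isProbabilityMeasure (alg.seedLaw : Measure U)
  have hne : ∀ n, Nonempty (Rec U S n)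
    | 0 => hU
    | _ + 1 => inferInstanceAs (Nonempty (ℝ × S))
  -- Whether the round of sample `n` is played is known after `n / H` complete rounds, hence from at
  -- most `n` samples.
  have hrun (n : ℕ) : ∃ D : Set (History U S n), MeasurableSet D ∧
      frestrictLe n ⁻¹' D = {ω | ((n / H : ℕ) : ℕ∞) < alg.τ ω} :=
    exists_preimage_of_roundFiltration (Nat.div_mul_le_self n H)
      (alg.isStoppingTime.measurableSet_gt (n / H))
  choose D hDm hD using hrun
  have hmemD (n : ℕ) (ω : (n : ℕ) → Rec U S n) :
      frestrictLe n ω ∈ D n ↔ ((n / H : ℕ) : ℕ∞) < alg.τ ω := by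
    rw [← Set.mem_preimage, hD]
    rfl
  set η : (n : ℕ) → Kernel (History U S n) (Rec U S (n + 1)) :=
    fun n => Kernel.piecewise (hDm n) (alg.stepKernel M' n) (alg.stepKernel M n) with hη
  have hηD (n : ℕ) (y : History U S n) (hy : y ∈ D n) : η n y = alg.stepKernel M' n y := by
    simp [hη, Kernel.piecewise_apply, hy]
  have hηD' (n : ℕ) (y : History U S n) (hy : y ∉ D n) : η n y = alg.stepKernel M n y := by
    simp [hη, Kernel.piecewise_apply, hy]
  have hac (n : ℕ) (y : History U S n) : alg.stepKernel M n y ≪ η n y := by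
    by_cases hy : y ∈ D n
    · rw [hηD n y hy]
      exact alg.stepKernel_absolutelyContinuous h n y
    · rw [hηD' n y hy]
  refine ⟨Kernel.trajMeasure (X := Rec U S) alg.initialLaw η, inferInstance, fun P t => ?_,
    fun n => ?_⟩
  · obtain ⟨B, hB, hBE⟩ := exists_preimage_of_roundFiltration le_rfl
      (alg.measurableSet_stop_output_mem P t)
    rw [← hBE, ← Measure.map_apply (measurable_frestrictLe _) hB,
      ← Measure.map_apply (measurable_frestrictLe _) hB]
    refine map_frestrictLe_trajMeasure_apply_eq _ _ _ hDm hηD _ hB fun y hy m hm => ?_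
    obtain ⟨ω, rfl⟩ := surjective_frestrictLe (X := Rec U S) (t * H) y
    have hω : alg.τ ω = t := by
      have : ω ∈ frestrictLe (t * H) ⁻¹' B := hy
      rw [hBE] at this
      exact this.1
    change frestrictLe m ω ∈ D m
    rw [hmemD, hω, Nat.cast_lt]
    exact (Nat.div_lt_iff_lt_mul (NeZero.pos H)).2 hm
  · refine (klDiv_map_frestrictLe_trajMeasure_le (X := Rec U S) alg.initialLaw
      (alg.stepKernel M) η hac n).trans ?_
    rw [← alg.tsum_select_mul_kl M M']
    -- The partial sum is bounded by the full series, so the bound does not depend on the horizon.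
    refine le_trans (Finset.sum_le_sum fun i _ => le_of_eq ?_) (ENNReal.sum_le_tsum (Finset.range n))
    have hpt (ω : (n : ℕ) → Rec U S n) :
        klDiv (alg.stepKernel M i (frestrictLe i ω)) (η i (frestrictLe i ω)) =
          ∑ x, {ω | ((i / H : ℕ) : ℕ∞) < alg.τ ω ∧ alg.select i (frestrictLe i ω) = x}.indicator
            (fun _ => M.kl M' (Fin.ofNat H i) x.1 x.2) ω := by
      by_cases hy : frestrictLe i ω ∈ D i
      · rw [hηD i _ hy, alg.klDiv_stepKernel h, Finset.sum_eq_single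
          (alg.select i (frestrictLe i ω)), Set.indicator_of_mem]
        · exact ⟨(hmemD i ω).1 hy, rfl⟩
        · exact fun x _ hx => Set.indicator_of_notMem (fun hω => hx hω.2.symm) _
        · simp
      · rw [hηD' i _ hy, klDiv_self]
        refine (Finset.sum_eq_zero fun x _ => Set.indicator_of_notMem (fun hω => hy ?_) _).symm
        exact (hmemD i ω).2 hω.1
    rw [lintegral_congr hpt, lintegral_finsetSum _ fun x _ =>
      measurable_const.indicator (alg.measurableSet_visit _ _ x)]
    refine Finset.sum_congr rfl fun x _ => ?_
    rw [lintegral_indicator_const (alg.measurableSet_visit _ _ x), mul_comm]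
    rfl

/-- The change of measure inequality: an algorithm whose output lies in `P` with probability at
least `1 - δ` under `M` and at most `δ` under `M'` has to collect enough information. -/
lemma bernoulliKL_le_sum_expectedVisits_mul_kl [Nonempty S] (alg : LearningAlgorithm U S A H)
    {M M' : EpisodicMDP S A H} (h : M.AbsCont M') {δ : ℝ} (hδ : 0 < δ) (hδ' : δ ≤ 1 / 2)
    (P : Set (Policy S A H))
    (hM : ENNReal.ofReal (1 - δ) ≤ alg.law M {x | alg.τ x ≠ ⊤ ∧ alg.output x ∈ P})
    (hM' : alg.law M' {x | alg.τ x ≠ ⊤ ∧ alg.output x ∈ P} ≤ ENNReal.ofReal δ) :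
    bernoulliKL δ (1 - δ) ≤ ∑ k, ∑ x, alg.expectedVisits M k x * M.kl M' k x.1 x.2 := by
  obtain ⟨Q, hQ, hQE, hQkl⟩ := alg.exists_stopped_law h
  set K := ∑ k, ∑ x, alg.expectedVisits M k x * M.kl M' k x.1 x.2 with hK
  by_cases hKtop : K = ∞
  · rw [hKtop]
    exact le_top
  set E : ℕ → Set ((n : ℕ) → Rec U S n) := fun t => {x | alg.τ x = t ∧ alg.output x ∈ P} with hE
  have hEm (t : ℕ) : MeasurableSet (E t) :=
    (roundFiltration U S H).le t _ (alg.measurableSet_stop_output_mem P t)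
  have hEd : Pairwise (Function.onFun Disjoint E) := fun s t hst =>
    Set.disjoint_left.2 fun x hs ht => hst (by exact_mod_cast hs.1.symm.trans ht.1)
  have hEU : ⋃ t, E t = {x | alg.τ x ≠ ⊤ ∧ alg.output x ∈ P} := by
    ext x
    simp only [hE, Set.mem_iUnion, Set.mem_ofPred_eq, exists_and_right, ENat.ne_top_iff_exists]
    exact and_congr_left fun _ => exists_congr fun _ => eq_comm
  have hQU : Q.real (⋃ t, E t) ≤ δ := by
    refine ENNReal.toReal_le_of_le_ofReal hδ.le ?_
    rw [measure_iUnion hEd hEm, tsum_congr (hQE P), ← measure_iUnion hEd hEm, hEU]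
    exact hM'
  have hMU : 1 - δ ≤ (alg.law M).real (⋃ t, E t) := by
    rw [hEU]
    exact (ENNReal.ofReal_le_iff_le_toReal (measure_ne_top _ _)).1 hM
  -- The multiplier `2 * L` is optimal in the Donsker-Varadhan bound for event probabilities `1 - δ`
  -- and `δ`; the logarithmic term is then exactly `L`.
  set L := Real.log ((1 - δ) / δ) with hL
  have hr : 1 ≤ (1 - δ) / δ := by
    rw [le_div_iff₀ hδ]
    linarith
  have hL0 : 0 ≤ L := Real.log_nonneg hr
  have hexp : Real.exp (2 * L) = ((1 - δ) / δ) ^ 2 := by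
    rw [two_mul, Real.exp_add, hL, Real.exp_log (by linarith), sq]
  have hbound (t : ℕ) : 2 * L * (alg.law M).real (Set.accumulate E t) - L ≤ K.toReal := by
    obtain ⟨B, hB, hBE⟩ : ∃ B : Set (History U S (t * H)), MeasurableSet B ∧
        frestrictLe (t * H) ⁻¹' B = Set.accumulate E t := by
      refine exists_preimage_of_roundFiltration le_rfl ?_
      refine MeasurableSet.biUnion (Set.to_countable _) fun s hs => ?_
      exact (roundFiltration U S H).mono hs _ (alg.measurableSet_stop_output_mem P s)
    have hp : IsProbabilityMeasure ((alg.law M).map (frestrictLe (t * H))) :=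
      Measure.isProbabilityMeasure_map (by fun_prop)
    have hq : IsProbabilityMeasure (Q.map (frestrictLe (t * H))) :=
      Measure.isProbabilityMeasure_map (by fun_prop)
    have hkl := hQkl (t * H)
    have key := mul_measureReal_sub_log_le_toReal_klDiv _ _ (ne_top_of_le_ne_top hKtop hkl) hB
      (2 * L)
    rw [map_measureReal_apply (measurable_frestrictLe _) hB,
      map_measureReal_apply (measurable_frestrictLe _) hB, hBE, hexp] at key
    have hq1 : Q.real (Set.accumulate E t) ≤ δ :=
      (measureReal_mono (Set.accumulate_subset_iUnion t)).trans hQU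
    have hq0 : 0 ≤ Q.real (Set.accumulate E t) := measureReal_nonneg
    have hlog : Real.log (1 - Q.real (Set.accumulate E t) +
        Q.real (Set.accumulate E t) * ((1 - δ) / δ) ^ 2) ≤ L := by
      -- Nonnegativity, from `δ ≤ 1 / 2`, makes the argument of the logarithm nondecreasing in the
      -- `Q`-probability, which can be replaced by its bound `δ`.
      have hr2 : 0 ≤ ((1 - δ) / δ) ^ 2 - 1 := by nlinarith
      refine Real.log_le_log (by nlinarith) ?_
      have e : 1 - δ + δ * ((1 - δ) / δ) ^ 2 = (1 - δ) / δ := by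
        field_simp
        ring
      nlinarith
    have := ENNReal.toReal_mono hKtop hkl
    linarith
  have hlim : Filter.Tendsto (fun t => 2 * L * (alg.law M).real (Set.accumulate E t) - L)
      Filter.atTop (nhds (2 * L * (alg.law M).real (⋃ t, E t) - L)) := by
    have h1 := tendsto_measure_iUnion_accumulate (μ := alg.law M) (f := E)
    have h2 := (ENNReal.tendsto_toReal (measure_ne_top (alg.law M) (⋃ t, E t))).comp h1
    exact (h2.const_mul (2 * L)).sub_const L
  have hfin := le_of_tendsto' hlim hbound
  rw [bernoulliKL_self_compl hδ (by linarith)]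
  refine ENNReal.ofReal_le_of_le_toReal (le_trans ?_ hfin)
  -- `2 * L * (1 - δ) - L = (1 - 2 * δ) * L`, the closed form of `kl(δ, 1 - δ)`.
  nlinarith

end LearningAlgorithm
end LinearRL

end

/-! ### The lower bound -/

theorem mainTheorem8 {U S : Type u} {A : Type v} {H d : ℕ} [NeZero H]
    [MeasurableSpace U]
    [Fintype S] [Nonempty S] [MeasurableSpace S] [MeasurableSingletonClass S]
    [Fintype A] [Nonempty A] [MeasurableSpace A] [MeasurableSingletonClass A]
    (φ : S → A → EuclideanSpace ℝ (Fin d)) (hφ : LinearRL.IsFeatureMap φ)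
    (ν : Measure ℝ) (hν : ν (Set.Icc 0 1)ᶜ = 0)
    (𝓜 : Set (LinearRL.EpisodicMDP S A H))
    (h𝓜 : 𝓜 ⊆ LinearRL.EpisodicMDP.linearMDPs φ ν)
    (δ ε : ℝ) (hδ : 0 < δ) (hδ' : δ ≤ 1 / 2) (hε : 0 < ε)
    (alg : LinearRL.LearningAlgorithm U S A H) (hPAC : alg.IsPAC 𝓜 δ ε)
    (M : LinearRL.EpisodicMDP S A H) (hM : M ∈ 𝓜) :
    M.charTime 𝓜 ε * LinearRL.bernoulliKL δ (1 - δ) ≤ alg.expectedSamples M := by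
  open LinearRL LinearRL.EpisodicMDP LinearRL.LearningAlgorithm in
  set k := bernoulliKL δ (1 - δ) with hk
  set T := alg.expectedSamples M with hT
  have key : ∀ M' ∈ alt 𝓜 ε M,
      k ≤ ∑ h, ∑ x, alg.expectedVisits M h x * M.kl M' h x.1 x.2 := by
    rintro M' ⟨hM', hac, hdisj⟩
    refine alg.bernoulliKL_le_sum_expectedVisits_mul_kl hac hδ hδ' (M.epsOptimal ε) (hPAC M hM) ?_
    set E := {x | alg.τ x ≠ ⊤ ∧ alg.output x ∈ M.epsOptimal ε} with hE
    have hEm : MeasurableSet E := by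
      have : E = ⋃ t : ℕ, {x | alg.τ x = t ∧ alg.output x ∈ M.epsOptimal ε} := by
        ext x
        simp only [hE, Set.mem_iUnion, Set.mem_ofPred_eq, exists_and_right,
          ENat.ne_top_iff_exists]
        exact and_congr_left fun _ => exists_congr fun _ => eq_comm
      rw [this]
      exact .iUnion fun t => (roundFiltration U S H).le t _ (alg.measurableSet_stop_output_mem _ t)
    have hsub : {x | alg.τ x ≠ ⊤ ∧ alg.output x ∈ M'.epsOptimal ε} ⊆ Eᶜ := fun x hx hxE =>
      Set.eq_empty_iff_forall_notMem.1 hdisj _ ⟨hxE.2, hx.2⟩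
    have h1 := (hPAC M' hM').trans (measure_mono hsub)
    rw [prob_compl_eq_one_sub hEm] at h1
    have h2 : alg.law M' E = 1 - (1 - alg.law M' E) :=
      (ENNReal.sub_sub_cancel ENNReal.one_ne_top prob_le_one).symm
    rw [h2]
    refine (tsub_le_tsub_left h1 1).trans ?_
    rw [← ENNReal.ofReal_one, ← ENNReal.ofReal_sub _ (by linarith)]
    simp
  rcases eq_or_ne T ∞ with hTtop | hTtop
  · rw [hTtop]
    exact le_top
  -- This includes `δ = 1 / 2`; the convention `∞ * 0 = 0` makes the claim trivial.
  rcases eq_or_ne k 0 with hk0 | hk0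
  · simp [hk0]
  have hvis (h : Fin H) : ∑ x, alg.expectedVisits M h x = T := alg.sum_expectedVisits M h
  have hvle (h : Fin H) (x : S × A) : alg.expectedVisits M h x ≤ T :=
    (hvis h) ▸ Finset.single_le_sum (fun _ _ => zero_le) (Finset.mem_univ x)
  have hle {ω : Fin H → S × A → ℝ} (hω : ∀ h, ω h ∈ stdSimplex ℝ (S × A)) :
      ⨅ M' ∈ alt 𝓜 ε M, ∑ h, ∑ x, ENNReal.ofReal (ω h x) * M.kl M' h x.1 x.2 ≤
        M.invCharTime 𝓜 ε :=
    le_iSup₂ (f := fun (ω : Fin H → S × A → ℝ)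
      (_ : ω ∈ {ω : Fin H → S × A → ℝ | ∀ h, ω h ∈ stdSimplex ℝ (S × A)}) =>
        ⨅ M' ∈ alt 𝓜 ε M, ∑ h, ∑ x, ENNReal.ofReal (ω h x) * M.kl M' h x.1 x.2) ω hω
  have hinv : k / T ≤ M.invCharTime 𝓜 ε := by
    rcases eq_or_ne T 0 with hT0 | hT0
    · have hempty : alt 𝓜 ε M = ∅ := by
        refine Set.eq_empty_of_forall_notMem fun M' hM' => hk0 ?_
        refine le_antisymm ((key M' hM').trans (le_of_eq ?_)) zero_le
        refine Finset.sum_eq_zero fun h _ => Finset.sum_eq_zero fun x _ => ?_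
        rw [le_antisymm ((hvle h x).trans hT0.le) zero_le, zero_mul]
      classical
      refine le_trans ?_ (hle fun _ => single_mem_stdSimplex ℝ (Classical.arbitrary (S × A)))
      simp [hempty]
    · set ω : Fin H → S × A → ℝ := fun h x => (alg.expectedVisits M h x / T).toReal with hω
      have hdiv (h : Fin H) (x : S × A) : alg.expectedVisits M h x / T ≠ ∞ :=
        ENNReal.div_ne_top (ne_top_of_le_ne_top hTtop (hvle h x)) hT0
      have hωmem (h : Fin H) : ω h ∈ stdSimplex ℝ (S × A) := by
        refine ⟨fun x => ENNReal.toReal_nonneg, ?_⟩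
        rw [hω, ← ENNReal.toReal_sum fun x _ => hdiv h x]
        simp_rw [div_eq_mul_inv]
        rw [← Finset.sum_mul, hvis, ENNReal.mul_inv_cancel hT0 hTtop, ENNReal.toReal_one]
      refine le_trans (le_iInf₂ fun M' hM' => ?_) (hle hωmem)
      refine (ENNReal.div_le_div_right (key M' hM') T).trans (le_of_eq ?_)
      simp_rw [hω, ENNReal.ofReal_toReal (hdiv _ _), div_eq_mul_inv, Finset.sum_mul]
      exact Finset.sum_congr rfl fun h _ => Finset.sum_congr rfl fun x _ => mul_right_comm _ _ _
  calc M.charTime 𝓜 ε * k ≤ (k / T)⁻¹ * k := by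
        gcongr
        exact ENNReal.inv_le_inv.2 hinv
    _ ≤ T := by
        rw [ENNReal.inv_div (.inl hTtop) (.inr hk0), mul_comm]
        exact ENNReal.mul_div_le
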